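/- A betweenness structure $\mathcal{B}=(X,\beta)$ is a nonempty finite set $X$ with a ternary relation $\beta\subseteq X^3$; write $(x\ y\ z)$ for $(x,y,z)\in\beta$. It is almost-metrizable if for all $x,y,z,w\in X$: $(x\ x\ z)$; $(x\ y\ z)\Rightarrow(z\ y\ x)$; $(x\ y\ z)\wedge(y\ x\ z)\Rightarrow x=y$; and $(x\ y\ z)\wedge(x\ w\ y)\Rightarrow(x\ w\ z)\wedge(w\ y\ z)$. An unordered triple of distinct points is collinear if its elements can be named $x,y,z$ so that $(x\ y\ z)$ holds, and is a triangle otherwise. The order of $\mathcal{B}$ is $|X|$ and its co-size is its number of triangles. For integers $n,m$ let $B(n,m)$ be the class of almost-metrizable betweenness structures of order $n$ and co-size $m$. For integers $k,c$ put $$\gamma(k,c)=\max\{n\in\mathbb{Z}: B(n,kn-c)\neq\emptyset\},\qquad \sigma(k,c)=\max\{n\in\mathbb{Z}: B(n,kn-c)=\emptyset\},$$ $$\vartheta_{\max}(k)=\max\{c\in\mathbb{Z}:\gamma(k,c)=\infty\},$$ where the maximum of a set of integers that is not bounded above is $\infty$. Then $$\vartheta_{\max}(2)=10,\qquad \sigma(2,10)=4,\qquad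 \gamma(2,c)=c-2\ \text{ for every integer } c>10,\qquad \gamma(2,10)=\infty.$$ -/

import Mathlib

/-- A betweenness structure: a nonempty finite ground set with a ternary relation;
`btw x y z` reads "`y` is between `x` and `z`". -/
structure BetweennessStructure where
  /-- the ground set -/
  X : Type
  [finite : Finite X]
  [nonempty : Nonempty X]
  /-- the betweenness relation -/
  btw : X → X → X → Prop

namespace BetweennessStructure

attribute [instance] BetweennessStructure.finite BetweennessStructure.nonempty

/-- The order: the number of points. -/
noncomputable def order (𝓑 : BetweennessStructure) : ℕ := Nat.card 𝓑.X

/-- A set of points is a collinear triple if it is `{x, y, z}` for some `x, y, z` such that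
`y` is between `x` and `z`. Below it is applied to sets with exactly three elements only. -/
def Collinear (𝓑 : BetweennessStructure) (T : Finset 𝓑.X) : Prop :=
  ∃ x y z : 𝓑.X, (T : Set 𝓑.X) = {x, y, z} ∧ 𝓑.btw x y z

/-- The triangles: the unordered triples of distinct points that are not collinear. -/
def triangles (𝓑 : BetweennessStructure) : Set (Finset 𝓑.X) :=
  {T | T.card = 3 ∧ ¬ 𝓑.Collinear T}

/-- The co-size: the number of triangles. -/
noncomputable def coSize (𝓑 : BetweennessStructure) : ℕ := 𝓑.triangles.ncard

/-- Almost-metrizable betweenness structures. -/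
structure AlmostMetrizable (𝓑 : BetweennessStructure) : Prop where
  refl_left : ∀ x z, 𝓑.btw x x z
  symm : ∀ x y z, 𝓑.btw x y z → 𝓑.btw z y x
  antisymm : ∀ x y z, 𝓑.btw x y z → 𝓑.btw y x z → x = y
  four_relations : ∀ x y z w, 𝓑.btw x y z → 𝓑.btw x w y → 𝓑.btw x w z ∧ 𝓑.btw w y z

/-- `B n m`: the almost-metrizable betweenness structures of order `n` and co-size `m`.
The parameters are integers; `B n m` is empty if `n ≤ 0` or `m < 0`. -/
def B (n m : ℤ) : Set BetweennessStructure :=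
  {𝓑 | 𝓑.AlmostMetrizable ∧ (𝓑.order : ℤ) = n ∧ (𝓑.coSize : ℤ) = m}

/-- The maximum of a set of integers as an extended integer: the greatest element if there
is one, `⊤` (i.e. `∞`) if the set is not bounded above, and `⊥` if the set is empty. -/
noncomputable def extMax (S : Set ℤ) : WithBot (WithTop ℤ) :=
  sSup ((fun n : ℤ => ((n : WithTop ℤ) : WithBot (WithTop ℤ))) '' S)

theorem extMax_eq_coe_iff (S : Set ℤ) (n : ℤ) :
    extMax S = ((n : WithTop ℤ) : WithBot (WithTop ℤ)) ↔ IsGreatest S n := by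
  constructor
  · intro h
    have hub : ∀ m ∈ S, m ≤ n := by
      intro m hm
      have := le_sSup (Set.mem_image_of_mem
        (fun n : ℤ => ((n : WithTop ℤ) : WithBot (WithTop ℤ))) hm)
      change _ ≤ extMax S at this
      rw [h] at this
      simpa using this
    refine ⟨?_, hub⟩
    by_contra hn
    have : extMax S ≤ (((n - 1 : ℤ) : WithTop ℤ) : WithBot (WithTop ℤ)) := by
      apply sSup_le
      rintro _ ⟨m, hm, rfl⟩
      have h1 := hub m hm
      have h2 : m ≠ n := fun e => hn (e ▸ hm)
      have h3 : m ≤ n - 1 := by omega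
      exact WithBot.coe_le_coe.2 (WithTop.coe_le_coe.2 h3)
    rw [h] at this
    have := WithTop.coe_le_coe.1 (WithBot.coe_le_coe.1 this)
    omega
  · intro h
    apply le_antisymm
    · apply sSup_le
      rintro _ ⟨m, hm, rfl⟩
      exact WithBot.coe_le_coe.2 (WithTop.coe_le_coe.2 (h.2 hm))
    · exact le_sSup (Set.mem_image_of_mem
        (fun n : ℤ => ((n : WithTop ℤ) : WithBot (WithTop ℤ))) h.1)

theorem extMax_eq_top_iff (S : Set ℤ) : extMax S = ⊤ ↔ ¬ BddAbove S := by
  constructor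
  · rintro h ⟨n, hn⟩
    have : extMax S ≤ ((n : WithTop ℤ) : WithBot (WithTop ℤ)) := by
      apply sSup_le
      rintro _ ⟨m, hm, rfl⟩
      exact WithBot.coe_le_coe.2 (WithTop.coe_le_coe.2 (hn hm))
    rw [h] at this
    exact WithTop.coe_ne_top (top_le_iff.1 (WithBot.coe_le_coe.1 this))
  · intro h
    by_contra hne
    apply h
    rcases S.eq_empty_or_nonempty with rfl | ⟨m, hm⟩
    · exact bddAbove_empty
    · have hle := le_sSup (Set.mem_image_of_mem
        (fun n : ℤ => ((n : WithTop ℤ) : WithBot (WithTop ℤ))) hm)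
      change _ ≤ extMax S at hle
      generalize hv : extMax S = v at hle hne
      induction v using WithBot.recBotCoe with
      | bot => simp at hle
      | coe v =>
        induction v using WithTop.recTopCoe with
        | top => exact absurd rfl hne
        | coe v => exact ⟨v, ((extMax_eq_coe_iff S v).1 hv).2⟩

/-- `γ(k, c) = max {n ∈ ℤ : B(n, kn - c) ≠ ∅}`. -/
noncomputable def gamma (k c : ℤ) : WithBot (WithTop ℤ) :=
  extMax {n : ℤ | B n (k * n - c) ≠ ∅}

/-- `σ(k, c) = max {n ∈ ℤ : B(n, kn - c) = ∅}`. -/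
noncomputable def sigma (k c : ℤ) : WithBot (WithTop ℤ) :=
  extMax {n : ℤ | B n (k * n - c) = ∅}

/-- `ϑ_max(k) = max {c ∈ ℤ : γ(k, c) = ∞}`. -/
noncomputable def thetaMax (k : ℤ) : WithBot (WithTop ℤ) :=
  extMax {c : ℤ | gamma k c = ⊤}

end BetweennessStructure

/-! Everything rests on a gap: an almost-metrizable structure of order n ≥ 7 has at most n - 2 or at
least 2n - 10 triangles (`coSize_gap`). Both ends are attained, by paths with doubled vertices.

Suppose first that all triangles of S pass through a point a, and regard them as the edges ij of a
graph on the other points. Given an edge ij, at most two points k are joined to neither i nor j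
(`card_special_le_two`): the local axioms leave few shapes for such a k, and no two of them can
coexist except one in which k is between i and j and one in which k is opposite to i or to j. So at
least |S| - 4 edges meet {i, j}. Two disjoint edges then give 2|S| - 10 edges in total. Otherwise
all edges meet pairwise, so they form a star, with at most |S| - 2 edges, or a graph triangle; for
|S| ≥ 7 the latter is impossible, as some further point must be joined to it.

An induction that deletes points (`exists_erase_eq_empty`) shows that at most 2|S| - 11 triangles
always pass through one point, once |S| ≥ 6.

For c > 10 the value 2n - c falls in the gap when n > c - 2 and equals n - 2 when n = c - 2. For c =
10 every order n ≥ 5 occurs. -/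

/-! ### Collinearity and configurations of few points -/

namespace BetweennessStructure

/-- Three points are collinear if one of them is between the other two. -/
def Col (𝓑 : BetweennessStructure) (x y z : 𝓑.X) : Prop :=
  𝓑.btw x y z ∨ 𝓑.btw y z x ∨ 𝓑.btw z x y

variable {𝓑 : BetweennessStructure}

theorem AlmostMetrizable.col_comm (h : 𝓑.AlmostMetrizable) {x y z : 𝓑.X} :
    𝓑.Col x y z ↔ 𝓑.Col x z y := by
  have := h.symm
  unfold Col
  grind

theorem col_rotate {x y z : 𝓑.X} : 𝓑.Col x y z ↔ 𝓑.Col y z x := by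
  unfold Col
  grind

theorem AlmostMetrizable.collinear_triple (h : 𝓑.AlmostMetrizable) [DecidableEq 𝓑.X]
    {x y z : 𝓑.X} (hxy : x ≠ y) (hxz : x ≠ z) (hyz : y ≠ z) :
    𝓑.Collinear {x, y, z} ↔ 𝓑.Col x y z := by
  constructor
  · rintro ⟨u, v, w, huvw, hb⟩
    have h1 : ∀ t, t ∈ ({x, y, z} : Finset 𝓑.X) ↔ t ∈ ({u, v, w} : Set 𝓑.X) := by
      intro t; rw [← huvw]; rfl
    simp only [Finset.mem_insert, Finset.mem_singleton, Set.mem_insert_iff,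
      Set.mem_singleton_iff] at h1
    have hx := (h1 x).1 (by simp)
    have hy := (h1 y).1 (by simp)
    have hz := (h1 z).1 (by simp)
    have := h.symm
    unfold Col
    grind
  · rintro (hb | hb | hb)
    · exact ⟨x, y, z, by simp, hb⟩
    · exact ⟨y, z, x, by ext; simp; tauto, hb⟩
    · exact ⟨z, x, y, by ext; simp; tauto, hb⟩

/-- A fifth point collinear with all pairs of a four-cycle does not exist. -/
theorem AlmostMetrizable.not_four_cycle (h : 𝓑.AlmostMetrizable) {x y z w v : 𝓑.X}
    (hxy : x ≠ y) (hxw : x ≠ w) (hyz : y ≠ z) (hzw : z ≠ w)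
    (hvx : v ≠ x) (hvy : v ≠ y) (hvz : v ≠ z) (hvw : v ≠ w)
    (cxy : 𝓑.Col v x y) (cxz : 𝓑.Col v x z) (cxw : 𝓑.Col v x w)
    (cyz : 𝓑.Col v y z) (cyw : 𝓑.Col v y w) (czw : 𝓑.Col v z w)
    (b1 : 𝓑.btw x y z) (b2 : 𝓑.btw y z w) (b3 : 𝓑.btw z w x) (b4 : 𝓑.btw w x y) : False := by
  have hs := h.symm
  have ha := h.antisymm
  have hf := h.four_relations
  unfold Col at *
  grind

/-- The four shapes of a triangle `a, i, j` with a fourth point `k` in no further triangle. -/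
theorem AlmostMetrizable.unique_triangle_cases (h : 𝓑.AlmostMetrizable) {a i j k : 𝓑.X}
    (hai : a ≠ i) (haj : a ≠ j) (hij : i ≠ j) (hka : k ≠ a) (hki : k ≠ i) (hkj : k ≠ j)
    (ht : ¬ 𝓑.Col a i j) (c1 : 𝓑.Col a i k) (c2 : 𝓑.Col a j k) (c3 : 𝓑.Col i j k) :
    (𝓑.btw i k j ∧ 𝓑.btw i k a ∧ 𝓑.btw j k a) ∨
    (𝓑.btw i k j ∧ 𝓑.btw k i a ∧ 𝓑.btw k j a) ∨
    (𝓑.btw k j i ∧ 𝓑.btw k a i ∧ 𝓑.btw a k j) ∨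
    (𝓑.btw k i j ∧ 𝓑.btw k a j ∧ 𝓑.btw a k i) := by
  have hs := h.symm
  have ha := h.antisymm
  have hf := h.four_relations
  unfold Col at *
  grind

/-- `x, y, z, w` form a four-cycle in this cyclic order. -/
def FourCycle (𝓑 : BetweennessStructure) (x y z w : 𝓑.X) : Prop :=
  𝓑.btw x y z ∧ 𝓑.btw y z w ∧ 𝓑.btw z w x ∧ 𝓑.btw w x y

/-- Without the four-cycle, k and l are linearly ordered between i and j. The relations with a then
either order k and l in both ways as seen from a, or contradict each other at i or j. -/
theorem AlmostMetrizable.between_unique (h : 𝓑.AlmostMetrizable) {a i j k l : 𝓑.X}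
    (hai : a ≠ i) (haj : a ≠ j) (hki : k ≠ i) (hkj : k ≠ j)
    (hla : l ≠ a) (hli : l ≠ i) (hlj : l ≠ j) (hkl : k ≠ l)
    (cikl : 𝓑.Col i k l) (cjkl : 𝓑.Col j k l) (n2 : ¬ 𝓑.FourCycle i k j l)
    (hk : (𝓑.btw i k j ∧ 𝓑.btw i k a ∧ 𝓑.btw j k a) ∨
      (𝓑.btw i k j ∧ 𝓑.btw k i a ∧ 𝓑.btw k j a))
    (hl : (𝓑.btw i l j ∧ 𝓑.btw i l a ∧ 𝓑.btw j l a) ∨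
      (𝓑.btw i l j ∧ 𝓑.btw l i a ∧ 𝓑.btw l j a)) : False := by
  have hs := h.symm
  have ha := h.antisymm
  have hf := h.four_relations
  unfold Col FourCycle at *
  grind

/-- The point i cannot lie between k and l, because a separates it from both. So one of k, l is
beyond the other as seen from i, and this yields both `btw l k a` and `btw k l a`. -/
theorem AlmostMetrizable.opposite_unique (h : 𝓑.AlmostMetrizable) {a i j k l : 𝓑.X}
    (hai : a ≠ i) (hka : k ≠ a) (hkj : k ≠ j) (hkl : k ≠ l)
    (cikl : 𝓑.Col i k l) (cjkl : 𝓑.Col j k l)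
    (hk : 𝓑.btw k j i ∧ 𝓑.btw k a i ∧ 𝓑.btw a k j)
    (hl : 𝓑.btw l j i ∧ 𝓑.btw l a i ∧ 𝓑.btw a l j) : False := by
  have hs := h.symm
  have ha := h.antisymm
  have hf := h.four_relations
  unfold Col at *
  grind

/-- The two shapes together force the four-cycle: `btw k l i` follows through a from `btw k a i` and
`btw a l i`, and `btw j k l` likewise. -/
theorem AlmostMetrizable.opposite_exclusive (h : 𝓑.AlmostMetrizable) {a i j k l : 𝓑.X}
    (hla : l ≠ a)
    (cjkl : 𝓑.Col j k l)
    (n3 : ¬ 𝓑.FourCycle i j k l)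
    (hk : 𝓑.btw k j i ∧ 𝓑.btw k a i ∧ 𝓑.btw a k j)
    (hl : 𝓑.btw l i j ∧ 𝓑.btw l a j ∧ 𝓑.btw a l i) : False := by
  have hs := h.symm
  have ha := h.antisymm
  have hf := h.four_relations
  unfold Col FourCycle at *
  grind

end BetweennessStructure

/-! ### Triangles through a point that meets all of them -/

namespace BetweennessStructure

open scoped Classical

variable {𝓑 : BetweennessStructure}

/-- The triangles contained in a finite set of points. -/
noncomputable def trianglesIn (𝓑 : BetweennessStructure) (S : Finset 𝓑.X) :
    Finset (Finset 𝓑.X) :=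
  {T ∈ S.powersetCard 3 | ¬ 𝓑.Collinear T}

theorem mem_trianglesIn {S T : Finset 𝓑.X} :
    T ∈ 𝓑.trianglesIn S ↔ T ⊆ S ∧ T.card = 3 ∧ ¬ 𝓑.Collinear T := by
  simp [trianglesIn, Finset.mem_powersetCard, and_assoc]

theorem AlmostMetrizable.triple_mem_trianglesIn (h : 𝓑.AlmostMetrizable) {S : Finset 𝓑.X}
    {x y z : 𝓑.X} (hxy : x ≠ y) (hxz : x ≠ z) (hyz : y ≠ z) :
    {x, y, z} ∈ 𝓑.trianglesIn S ↔ x ∈ S ∧ y ∈ S ∧ z ∈ S ∧ ¬ 𝓑.Col x y z := by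
  rw [mem_trianglesIn, h.collinear_triple hxy hxz hyz, Finset.card_eq_three.2
    ⟨x, y, z, hxy, hxz, hyz, rfl⟩]
  simp [Finset.insert_subset_iff, and_assoc]

theorem AlmostMetrizable.col_of_trianglesIn_eq_empty (h : 𝓑.AlmostMetrizable)
    {S : Finset 𝓑.X} (hS : 𝓑.trianglesIn S = ∅) {x y z : 𝓑.X} (hx : x ∈ S) (hy : y ∈ S)
    (hz : z ∈ S) (hxy : x ≠ y) (hxz : x ≠ z) (hyz : y ≠ z) : 𝓑.Col x y z := by
  by_contra hc
  have := (h.triple_mem_trianglesIn hxy hxz hyz).2 ⟨hx, hy, hz, hc⟩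
  simp [hS] at this

theorem trianglesIn_mono {S S' : Finset 𝓑.X} (hS : S ⊆ S') :
    𝓑.trianglesIn S ⊆ 𝓑.trianglesIn S' := by
  intro T
  simp only [mem_trianglesIn]
  exact fun ⟨h1, h2⟩ => ⟨h1.trans hS, h2⟩

theorem mem_trianglesIn_erase {S T : Finset 𝓑.X} {a : 𝓑.X} :
    T ∈ 𝓑.trianglesIn (S.erase a) ↔ T ∈ 𝓑.trianglesIn S ∧ a ∉ T := by
  simp only [mem_trianglesIn, Finset.subset_erase]
  tauto

theorem trianglesIn_erase_eq_empty_iff {S : Finset 𝓑.X} {a : 𝓑.X} :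
    𝓑.trianglesIn (S.erase a) = ∅ ↔ ∀ T ∈ 𝓑.trianglesIn S, a ∈ T := by
  simp only [Finset.eq_empty_iff_forall_notMem, mem_trianglesIn_erase]
  grind

/-- A triangle through `a` is `{a, i, j}` for two further points `i` and `j`. -/
theorem exists_eq_of_mem_trianglesIn {S T : Finset 𝓑.X} {a : 𝓑.X}
    (hT : T ∈ 𝓑.trianglesIn S) (ha : a ∈ T) :
    ∃ i j, i ∈ S ∧ j ∈ S ∧ a ≠ i ∧ a ≠ j ∧ i ≠ j ∧ T = {a, i, j} := by
  obtain ⟨h1, h2, -⟩ := mem_trianglesIn.1 hT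
  have : (T.erase a).card = 2 := by rw [Finset.card_erase_of_mem ha, h2]
  obtain ⟨i, j, hij, he⟩ := Finset.card_eq_two.1 this
  have hi : i ∈ T.erase a := by rw [he]; simp
  have hj : j ∈ T.erase a := by rw [he]; simp
  rw [Finset.mem_erase] at hi hj
  exact ⟨i, j, h1 hi.2, h1 hj.2, hi.1.symm, hj.1.symm, hij, by
    rw [← he, Finset.insert_erase ha]⟩

/-- If the points of `S` other than `a` are collinear, then at most two points of `S` form no
further triangle with a given triangle `a, i, j`. -/
theorem AlmostMetrizable.card_special_le_two (h : 𝓑.AlmostMetrizable) {S : Finset 𝓑.X}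
    {a i j : 𝓑.X} (hS : 𝓑.trianglesIn (S.erase a) = ∅) (hi : i ∈ S) (hj : j ∈ S)
    (hai : a ≠ i) (haj : a ≠ j) (hij : i ≠ j) (ht : ¬ 𝓑.Col a i j) :
    {k ∈ S | k ≠ a ∧ k ≠ i ∧ k ≠ j ∧ 𝓑.Col a i k ∧ 𝓑.Col a j k}.card ≤ 2 := by
  have col : ∀ x ∈ S, ∀ y ∈ S, ∀ z ∈ S, x ≠ a → y ≠ a → z ≠ a → x ≠ y → x ≠ z → y ≠ z →
      𝓑.Col x y z := fun x hx y hy z hz ax ay az =>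
    h.col_of_trianglesIn_eq_empty hS (Finset.mem_erase.2 ⟨ax, hx⟩)
      (Finset.mem_erase.2 ⟨ay, hy⟩) (Finset.mem_erase.2 ⟨az, hz⟩)
  let K := {k ∈ S | k ≠ a ∧ k ≠ i ∧ k ≠ j ∧ 𝓑.Col a i k ∧ 𝓑.Col a j k}
  have hK : ∀ k ∈ K, k ∈ S ∧ k ≠ a ∧ k ≠ i ∧ k ≠ j ∧ 𝓑.Col a i k ∧ 𝓑.Col a j k :=
    fun k hk => Finset.mem_filter.1 hk
  let P : 𝓑.X → Prop := fun k =>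
    (𝓑.btw i k j ∧ 𝓑.btw i k a ∧ 𝓑.btw j k a) ∨ (𝓑.btw i k j ∧ 𝓑.btw k i a ∧ 𝓑.btw k j a)
  let Q : 𝓑.X → Prop := fun k => 𝓑.btw k j i ∧ 𝓑.btw k a i ∧ 𝓑.btw a k j
  let R : 𝓑.X → Prop := fun k => 𝓑.btw k i j ∧ 𝓑.btw k a j ∧ 𝓑.btw a k i
  have cases : ∀ k ∈ K, P k ∨ Q k ∨ R k := by
    intro k hk
    obtain ⟨k0, k1, k2, k3, k4, k5⟩ := hK k hk
    rcases h.unique_triangle_cases hai haj hij k1 k2 k3 ht k4 k5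
      (col i hi j hj k k0 hai.symm haj.symm k1 hij k2.symm k3.symm) with hc | hc | hc | hc
    exacts [.inl (.inl hc), .inl (.inr hc), .inr (.inl hc), .inr (.inr hc)]
  -- The third point m serves only to exclude the four-cycles, via `not_four_cycle`. What remains is
  -- at most one point of shape P and one of shape Q or R.
  have excl : ∀ k ∈ K, ∀ l ∈ K, ∀ m ∈ K, k ≠ l → k ≠ m → l ≠ m →
      ¬ (P k ∧ P l) ∧ ¬ (Q k ∧ Q l) ∧ ¬ (R k ∧ R l) ∧ ¬ (Q k ∧ R l) := by
    intro k hk l hl m hm hkl hkm hlm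
    obtain ⟨k0, k1, k2, k3, -, -⟩ := hK k hk
    obtain ⟨l0, l1, l2, l3, -, -⟩ := hK l hl
    obtain ⟨m0, m1, m2, m3, -, -⟩ := hK m hm
    have c1 := col i hi k k0 l l0 hai.symm k1 l1 k2.symm l2.symm hkl
    have c2 := col j hj k k0 l l0 haj.symm k1 l1 k3.symm l3.symm hkl
    have d1 := col m m0 i hi j hj m1 hai.symm haj.symm m2 m3 hij
    have d2 := col m m0 i hi k k0 m1 hai.symm k1 m2 hkm.symm k2.symm
    have d3 := col m m0 i hi l l0 m1 hai.symm l1 m2 hlm.symm l2.symm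
    have d4 := col m m0 j hj k k0 m1 haj.symm k1 m3 hkm.symm k3.symm
    have d5 := col m m0 j hj l l0 m1 haj.symm l1 m3 hlm.symm l3.symm
    have d6 := col m m0 k k0 l l0 m1 k1 l1 hkm.symm hlm.symm hkl
    have e2 : ¬ 𝓑.FourCycle i k j l := fun ⟨b1, b2, b3, b4⟩ =>
      h.not_four_cycle k2.symm l2.symm k3 l3.symm m2 hkm.symm m3 hlm.symm
        d2 d1 d3 (h.col_comm.1 d4) d6 d5 b1 b2 b3 b4
    have e3 : ¬ 𝓑.FourCycle i j k l := fun ⟨b1, b2, b3, b4⟩ =>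
      h.not_four_cycle hij l2.symm k3.symm hkl m2 m3 hkm.symm hlm.symm
        d1 d2 d3 d4 d5 d6 b1 b2 b3 b4
    exact ⟨fun ⟨p, q⟩ => h.between_unique hai haj k2 k3 l1 l2 l3 hkl c1 c2 e2 p q,
      fun ⟨p, q⟩ => h.opposite_unique hai k1 k3 hkl c1 c2 p q,
      fun ⟨p, q⟩ => h.opposite_unique haj k1 k2 hkl c2 c1 p q,
      fun ⟨p, q⟩ => h.opposite_exclusive l1 c2 e3 p q⟩
  by_contra! hcard
  obtain ⟨k, hk, l, hl, m, hm, hkl, hkm, hlm⟩ := Finset.two_lt_card.1 hcard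
  have := excl k hk l hl m hm hkl hkm hlm
  have := excl l hl k hk m hm hkl.symm hlm hkm
  have := excl k hk m hm l hl hkm hkl hlm.symm
  have := excl m hm k hk l hl hkm.symm hlm.symm hkl
  have := excl l hl m hm k hk hlm hkl.symm hkm.symm
  have := excl m hm l hl k hk hlm.symm hkm.symm hkl.symm
  have := cases k hk
  have := cases l hl
  have := cases m hm
  clear excl cases hK col
  clear_value P Q R
  grind

/-- Besides {a, i, j} itself, each of the at least |S| - 3 - 2 non-special points contributes its
own triangle with a and one of i, j. -/
theorem AlmostMetrizable.card_triangles_meeting (h : 𝓑.AlmostMetrizable) {S : Finset 𝓑.X}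
    {a i j : 𝓑.X} (ha : a ∈ S) (hS : 𝓑.trianglesIn (S.erase a) = ∅) (hi : i ∈ S) (hj : j ∈ S)
    (hai : a ≠ i) (haj : a ≠ j) (hij : i ≠ j) (ht : ¬ 𝓑.Col a i j) :
    S.card ≤ {T ∈ 𝓑.trianglesIn S | i ∈ T ∨ j ∈ T}.card + 4 := by
  let N := {k ∈ S | k ≠ a ∧ k ≠ i ∧ k ≠ j ∧ ¬ (𝓑.Col a i k ∧ 𝓑.Col a j k)}
  have hcov : S ⊆ N ∪ {k ∈ S | k ≠ a ∧ k ≠ i ∧ k ≠ j ∧ 𝓑.Col a i k ∧ 𝓑.Col a j k} ∪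
      {a, i, j} := by
    intro k hk
    simp only [N, Finset.mem_union, Finset.mem_filter, Finset.mem_insert,
      Finset.mem_singleton]
    tauto
  have h1 : S.card ≤ N.card + 2 + 3 :=
    (Finset.card_le_card hcov).trans <| (Finset.card_union_le _ _).trans <|
      Nat.add_le_add ((Finset.card_union_le _ _).trans <|
        Nat.add_le_add_left (h.card_special_le_two hS hi hj hai haj hij ht) _)
        Finset.card_le_three
  let f : 𝓑.X → Finset 𝓑.X := fun k => if 𝓑.Col a i k then {a, j, k} else {a, i, k}
  have hinj : Set.InjOn f N := by
    intro k hk l hl hkl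
    simp only [N, Finset.coe_filter, Set.mem_ofPred_eq] at hk hl
    have hm : k ∈ f l := by rw [← hkl]; simp only [f]; split_ifs <;> simp
    simp only [f] at hm
    split_ifs at hm <;> simp at hm <;> tauto
  have hsub : insert {a, i, j} (N.image f) ⊆ {T ∈ 𝓑.trianglesIn S | i ∈ T ∨ j ∈ T} := by
    intro T hT
    rcases Finset.mem_insert.1 hT with rfl | hT
    · simp [h.triple_mem_trianglesIn hai haj hij, ha, hi, hj, ht]
    · obtain ⟨k, hk, rfl⟩ := Finset.mem_image.1 hT
      obtain ⟨k0, k1, k2, k3, k4⟩ := Finset.mem_filter.1 hk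
      simp only [f, Finset.mem_filter]
      split_ifs with hc
      · rw [h.triple_mem_trianglesIn haj k1.symm k3.symm]
        exact ⟨⟨ha, hj, k0, fun hc' => k4 ⟨hc, hc'⟩⟩, by simp⟩
      · rw [h.triple_mem_trianglesIn hai k1.symm k2.symm]
        exact ⟨⟨ha, hi, k0, hc⟩, by simp⟩
  have hnot : {a, i, j} ∉ N.image f := by
    intro hT
    obtain ⟨k, hk, he⟩ := Finset.mem_image.1 hT
    obtain ⟨k0, k1, k2, k3, k4⟩ := Finset.mem_filter.1 hk
    have hm : k ∈ ({a, i, j} : Finset 𝓑.X) := by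
      rw [← he]; simp only [f]; split_ifs <;> simp
    simp at hm
    tauto
  have := Finset.card_le_card hsub
  rw [Finset.card_insert_of_notMem hnot, Finset.card_image_of_injOn hinj] at this
  omega

end BetweennessStructure

/-! ### The gap between n - 2 and 2n - 10 -/

namespace BetweennessStructure

open scoped Classical

variable {𝓑 : BetweennessStructure}

theorem AlmostMetrizable.card_trianglesIn_of_mem (h : 𝓑.AlmostMetrizable) {S T : Finset 𝓑.X}
    {a : 𝓑.X} (hS : 𝓑.trianglesIn (S.erase a) = ∅) (hT : T ∈ 𝓑.trianglesIn S) :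
    S.card ≤ (𝓑.trianglesIn S).card + 4 := by
  have haT := trianglesIn_erase_eq_empty_iff.1 hS T hT
  obtain ⟨i, j, hi, hj, hai, haj, hij, rfl⟩ := exists_eq_of_mem_trianglesIn hT haT
  obtain ⟨ha, -, -, ht⟩ := (h.triple_mem_trianglesIn hai haj hij).1 hT
  exact (h.card_triangles_meeting ha hS hi hj hai haj hij ht).trans
    (Nat.add_le_add_right (Finset.card_le_card (Finset.filter_subset _ _)) _)

/-- At least |S| - 4 triangles meet {i, j}. Deleting i and j keeps {a, p, q}, so at least (|S| - 2)
- 4 further triangles avoid both. -/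
theorem AlmostMetrizable.card_trianglesIn_of_disjoint (h : 𝓑.AlmostMetrizable)
    {S : Finset 𝓑.X} {a i j p q : 𝓑.X} (ha : a ∈ S) (hS : 𝓑.trianglesIn (S.erase a) = ∅)
    (hi : i ∈ S) (hj : j ∈ S) (hp : p ∈ S) (hq : q ∈ S)
    (hai : a ≠ i) (haj : a ≠ j) (hij : i ≠ j) (hap : a ≠ p) (haq : a ≠ q) (hpq : p ≠ q)
    (hpi : p ≠ i) (hpj : p ≠ j) (hqi : q ≠ i) (hqj : q ≠ j)
    (hij' : ¬ 𝓑.Col a i j) (hpq' : ¬ 𝓑.Col a p q) :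
    2 * S.card ≤ (𝓑.trianglesIn S).card + 10 := by
  have h1 := h.card_triangles_meeting ha hS hi hj hai haj hij hij'
  let S' := (S.erase i).erase j
  have hS' : 𝓑.trianglesIn (S'.erase a) = ∅ := by
    rw [← Finset.subset_empty, ← hS]
    exact trianglesIn_mono (Finset.erase_subset_erase _
      ((Finset.erase_subset _ _).trans (Finset.erase_subset _ _)))
  have h2 : S'.card ≤ (𝓑.trianglesIn S').card + 4 :=
    h.card_trianglesIn_of_mem hS' (T := {a, p, q})
      ((h.triple_mem_trianglesIn hap haq hpq).2 ⟨by simp [S', *], by simp [S', *],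
        by simp [S', *], hpq'⟩)
  have h3 : S'.card + 2 = S.card := by
    change ((S.erase i).erase j).card + 2 = S.card
    have : j ∈ S.erase i := by simp [hij.symm, hj]
    have := Finset.card_erase_add_one this
    have := Finset.card_erase_add_one hi
    omega
  have h4 : 𝓑.trianglesIn S' = {T ∈ 𝓑.trianglesIn S | ¬ (i ∈ T ∨ j ∈ T)} := by
    ext T
    simp only [S', mem_trianglesIn_erase, Finset.mem_filter]
    tauto
  have h5 := Finset.card_filter_add_card_filter_not (s := 𝓑.trianglesIn S)
    (fun T => i ∈ T ∨ j ∈ T)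
  rw [h4] at h2
  omega

/-- If two points lie in all triangles, there are few triangles. -/
theorem card_trianglesIn_le_of_forall_mem {S : Finset 𝓑.X} {a b : 𝓑.X} (ha : a ∈ S)
    (hb : b ∈ S) (hab : a ≠ b) (hT : ∀ T ∈ 𝓑.trianglesIn S, a ∈ T ∧ b ∈ T) :
    (𝓑.trianglesIn S).card + 2 ≤ S.card := by
  have hsub : 𝓑.trianglesIn S ⊆ ((S.erase a).erase b).image fun k => {a, b, k} := by
    intro T hTS
    obtain ⟨haT, hbT⟩ := hT T hTS
    obtain ⟨i, j, hi, hj, hai, haj, hij, rfl⟩ := exists_eq_of_mem_trianglesIn hTS haT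
    simp only [Finset.mem_image, Finset.mem_erase]
    simp only [Finset.mem_insert, Finset.mem_singleton] at hbT
    rcases hbT with hb' | rfl | rfl
    · exact absurd hb'.symm hab
    · exact ⟨j, ⟨hij.symm, haj.symm, hj⟩, rfl⟩
    · exact ⟨i, ⟨hij, hai.symm, hi⟩, by rw [Finset.pair_comm]⟩
  have h1 := (Finset.card_le_card hsub).trans Finset.card_image_le
  have : b ∈ S.erase a := by simp [hab.symm, hb]
  have := Finset.card_erase_add_one this
  have := Finset.card_erase_add_one ha
  omega

theorem AlmostMetrizable.card_trianglesIn_of_erase (h : 𝓑.AlmostMetrizable) {S : Finset 𝓑.X}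
    {a : 𝓑.X} (ha : a ∈ S) (hcard : 7 ≤ S.card) (hS : 𝓑.trianglesIn (S.erase a) = ∅) :
    (𝓑.trianglesIn S).card + 2 ≤ S.card ∨ 2 * S.card ≤ (𝓑.trianglesIn S).card + 10 := by
  have hmem := trianglesIn_erase_eq_empty_iff.1 hS
  by_cases hstar : ∃ b ∈ S, a ≠ b ∧ ∀ T ∈ 𝓑.trianglesIn S, b ∈ T
  · obtain ⟨b, hb, hab, hT⟩ := hstar
    exact .inl (card_trianglesIn_le_of_forall_mem ha hb hab fun T h1 => ⟨hmem T h1, hT T h1⟩)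
  push Not at hstar
  have avoid : ∀ b ∈ S, a ≠ b → ∃ p q, p ∈ S ∧ q ∈ S ∧ a ≠ p ∧ a ≠ q ∧ p ≠ q ∧ p ≠ b ∧ q ≠ b ∧
      ¬ 𝓑.Col a p q := by
    intro b hb hab
    obtain ⟨T, hT, hbT⟩ := hstar b hb hab
    obtain ⟨p, q, hp, hq, hap, haq, hpq, rfl⟩ := exists_eq_of_mem_trianglesIn hT (hmem T hT)
    simp only [Finset.mem_insert, Finset.mem_singleton, not_or] at hbT
    exact ⟨p, q, hp, hq, hap, haq, hpq, Ne.symm hbT.2.1, Ne.symm hbT.2.2,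
      ((h.triple_mem_trianglesIn hap haq hpq).1 hT).2.2.2⟩
  have comm : ∀ x y, 𝓑.Col a x y → 𝓑.Col a y x := fun x y => h.col_comm.1
  right
  by_contra! hlt
  have meet : ∀ i j p q, i ∈ S → j ∈ S → p ∈ S → q ∈ S → a ≠ i → a ≠ j → i ≠ j → a ≠ p →
      a ≠ q → p ≠ q → ¬ 𝓑.Col a i j → ¬ 𝓑.Col a p q → p = i ∨ p = j ∨ q = i ∨ q = j := by
    intro i j p q hi hj hp hq hai haj hij hap haq hpq h1 h2
    by_contra! hne
    exact absurd (h.card_trianglesIn_of_disjoint ha hS hi hj hp hq hai haj hij hap haq hpq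
      hne.1 hne.2.1 hne.2.2.1 hne.2.2.2 h1 h2) (by omega)
  have next : ∀ i j, i ∈ S → j ∈ S → a ≠ i → a ≠ j → i ≠ j → ¬ 𝓑.Col a i j →
      ∃ k ∈ S, a ≠ k ∧ k ≠ i ∧ k ≠ j ∧ ¬ 𝓑.Col a j k := by
    intro i j hi hj hai haj hij tij
    obtain ⟨p, q, hp, hq, hap, haq, hpq, hpi, hqi, tpq⟩ := avoid i hi hai
    rcases meet i j p q hi hj hp hq hai haj hij hap haq hpq tij tpq with e | rfl | e | rfl
    · exact absurd e hpi
    · exact ⟨q, hq, haq, hqi, hpq.symm, tpq⟩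
    · exact absurd e hqi
    · exact ⟨p, hp, hap, hpi, hpq, fun hc => tpq (comm _ _ hc)⟩
  -- Pairwise meeting edges without a common point form a graph triangle i, j, k.
  obtain ⟨b, hb⟩ : (S.erase a).Nonempty := by
    rw [← Finset.card_pos, Finset.card_erase_of_mem ha]
    omega
  obtain ⟨i, j, hi, hj, hai, haj, hij, -, -, tij⟩ :=
    avoid b (Finset.mem_of_mem_erase hb) (Finset.ne_of_mem_erase hb).symm
  obtain ⟨k, hk, hak, hki, hkj, tjk⟩ := next i j hi hj hai haj hij tij
  obtain ⟨l, hl, hal, hlj, hli, til⟩ := next j i hj hi haj hai hij.symm fun hc =>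
    tij (comm _ _ hc)
  obtain rfl : k = l := by
    rcases meet j k i l hj hk hi hl haj hak hkj.symm hai hal hli.symm tjk til with
      e | e | e | e
    exacts [absurd e hij, absurd e.symm hki, absurd e hlj, e.symm]
  have h2 := h.card_special_le_two hS hi hj hai haj hij tij
  have h3 : ({a, i, j, k} : Finset 𝓑.X).card ≤ 4 := Finset.card_le_four
  -- Two special points and a, i, j, k are at most six points, but |S| ≥ 7. The remaining point m
  -- has an edge to j, disjoint from ik, or to i, disjoint from jk.
  have hnsub : ¬ S ⊆ {k ∈ S | k ≠ a ∧ k ≠ i ∧ k ≠ j ∧ 𝓑.Col a i k ∧ 𝓑.Col a j k} ∪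
      {a, i, j, k} := by
    intro hsub
    have := (Finset.card_le_card hsub).trans (Finset.card_union_le _ _)
    omega
  obtain ⟨m, hm, hm'⟩ := Finset.not_subset.1 hnsub
  simp only [Finset.mem_union, Finset.mem_filter, Finset.mem_insert, Finset.mem_singleton,
    not_or] at hm'
  obtain ⟨hms, hma, hmi, hmj, hmk⟩ := hm'
  by_cases hc : 𝓑.Col a i m
  · have tjm : ¬ 𝓑.Col a j m := fun hc' => hms ⟨hm, hma, hmi, hmj, hc, hc'⟩
    rcases meet i k j m hi hk hj hm hai hak hki.symm haj (Ne.symm hma) (Ne.symm hmj) til tjm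
      with e | e | e | e
    exacts [hij e.symm, hkj e.symm, hmi e, hmk e]
  · rcases meet j k i m hj hk hi hm haj hak hkj.symm hai (Ne.symm hma) (Ne.symm hmi) tjk hc
      with e | e | e | e
    exacts [hij e, hki e.symm, hmj e, hmk e]

/-- If there are more than a third as many triangles as points, two of them share a point. -/
theorem exists_two_le_card_filter_mem {S : Finset 𝓑.X}
    (hcard : S.card < 3 * (𝓑.trianglesIn S).card) :
    ∃ x ∈ S, 2 ≤ {T ∈ 𝓑.trianglesIn S | x ∈ T}.card := by
  by_contra! hlt
  have h1 : ∑ x ∈ S, {T ∈ 𝓑.trianglesIn S | x ∈ T}.card ≤ ∑ x ∈ S, 1 :=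
    Finset.sum_le_sum fun x hx => Nat.lt_succ_iff.1 (hlt x hx)
  have h2 : ∑ x ∈ S, {T ∈ 𝓑.trianglesIn S | x ∈ T}.card =
      ∑ T ∈ 𝓑.trianglesIn S, {x ∈ S | x ∈ T}.card :=
    Finset.sum_card_bipartiteAbove_eq_sum_card_bipartiteBelow _
  have h3 : ∑ T ∈ 𝓑.trianglesIn S, {x ∈ S | x ∈ T}.card = ∑ T ∈ 𝓑.trianglesIn S, 3 := by
    refine Finset.sum_congr rfl fun T hT => ?_
    obtain ⟨hsub, hT3, -⟩ := mem_trianglesIn.1 hT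
    rw [Finset.filter_mem_eq_inter, Finset.inter_eq_right.2 hsub, hT3]
  rw [h2, h3] at h1
  simp at h1
  omega

theorem AlmostMetrizable.exists_erase_eq_empty (h : 𝓑.AlmostMetrizable) (S : Finset 𝓑.X)
    (hcard : 6 ≤ S.card) (hS : (𝓑.trianglesIn S).card + 11 ≤ 2 * S.card) :
    ∃ a ∈ S, 𝓑.trianglesIn (S.erase a) = ∅ := by
  induction hn : S.card generalizing S with
  | zero => omega
  | succ n ih =>
    rcases (𝓑.trianglesIn S).eq_empty_or_nonempty with h0 | ⟨T, hT⟩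
    · obtain ⟨a, ha⟩ : S.Nonempty := Finset.card_pos.1 (by omega)
      exact ⟨a, ha, trianglesIn_erase_eq_empty_iff.2 (by simp [h0])⟩
    have hsplit : ∀ x, {T ∈ 𝓑.trianglesIn S | x ∈ T}.card +
        (𝓑.trianglesIn (S.erase x)).card = (𝓑.trianglesIn S).card := by
      intro x
      rw [← Finset.card_filter_add_card_filter_not (s := 𝓑.trianglesIn S) (fun T => x ∈ T)]
      congr 2
      ext T
      simp [mem_trianglesIn_erase]
    obtain ⟨hTS, hT3, -⟩ := mem_trianglesIn.1 hT
    obtain ⟨t, ht⟩ : T.Nonempty := Finset.card_pos.1 (by omega)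
    have hdeg : 1 ≤ {T ∈ 𝓑.trianglesIn S | t ∈ T}.card :=
      Finset.card_pos.2 ⟨T, by simp [hT, ht]⟩
    -- With six points there is at most one triangle, and any of its vertices will do.
    rcases hcard.eq_or_lt with h6 | h7
    · refine ⟨t, hTS ht, Finset.card_eq_zero.1 ?_⟩
      have := hsplit t
      omega
    -- The induction hypothesis for |S| - 1 points allows two triangles fewer, so x should lie in
    -- two of them. If no such x is available, there are at most |S|/3 triangles, and one is enough.
    obtain ⟨x, hx, hx'⟩ : ∃ x ∈ S, (𝓑.trianglesIn (S.erase x)).card + 13 ≤ 2 * S.card := by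
      by_cases hlt : S.card < 3 * (𝓑.trianglesIn S).card
      · obtain ⟨x, hx, h2⟩ := exists_two_le_card_filter_mem hlt
        exact ⟨x, hx, by have := hsplit x; omega⟩
      · exact ⟨t, hTS ht, by have := hsplit t; omega⟩
    have hcx := Finset.card_erase_add_one hx
    obtain ⟨b, hb, hbx⟩ := ih (S.erase x) (by omega) (by omega) (by omega)
    have hb' := Finset.mem_of_mem_erase hb
    have hcb := Finset.card_erase_add_one hb'
    -- If neither x nor b lies in all triangles, those avoiding x and those avoiding b are disjoint
    -- families, each of size at least (|S| - 1) - 4. Together they exceed the bound 2|S| - 11.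
    by_contra! hne
    obtain ⟨T₁, h1⟩ := hne x hx
    obtain ⟨T₂, h2⟩ := hne b hb'
    have g1 := h.card_trianglesIn_of_mem hbx h1
    have g2 := h.card_trianglesIn_of_mem (a := x) (by rwa [Finset.erase_right_comm]) h2
    have hdisj : Disjoint (𝓑.trianglesIn (S.erase x)) (𝓑.trianglesIn (S.erase b)) := by
      rw [Finset.disjoint_left]
      intro T hTx hTb
      exact (mem_trianglesIn_erase.1 hTb).2 (trianglesIn_erase_eq_empty_iff.1 hbx T hTx)
    have := Finset.card_le_card (Finset.union_subset
      (trianglesIn_mono (𝓑 := 𝓑) (Finset.erase_subset x S))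
      (trianglesIn_mono (Finset.erase_subset b S)))
    rw [Finset.card_union_of_disjoint hdisj] at this
    omega

/-- There is no co-size strictly between `n - 2` and `2 n - 10`. -/
theorem AlmostMetrizable.coSize_gap (h : 𝓑.AlmostMetrizable) (hn : 7 ≤ 𝓑.order) :
    𝓑.coSize + 2 ≤ 𝓑.order ∨ 2 * 𝓑.order ≤ 𝓑.coSize + 10 := by
  have := Fintype.ofFinite 𝓑.X
  have h1 : 𝓑.order = (Finset.univ : Finset 𝓑.X).card := by
    rw [order, Nat.card_eq_fintype_card, Finset.card_univ]
  have h2 : 𝓑.coSize = (𝓑.trianglesIn Finset.univ).card := by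
    rw [coSize, ← Set.ncard_coe_finset]
    congr 1
    ext T
    simp [triangles, mem_trianglesIn]
  rw [h1] at hn ⊢
  rw [h2]
  by_contra! hlt
  obtain ⟨a, ha, hS⟩ := h.exists_erase_eq_empty Finset.univ (by omega) (by omega)
  have := h.card_trianglesIn_of_erase ha hn hS
  omega

end BetweennessStructure

/-! ### Extremal examples: paths with doubled vertices -/

namespace BetweennessStructure

/-- The betweenness structure of a distance function on `Fin n`. -/
abbrev ofDist (n : ℕ) [NeZero n] (d : Fin n → Fin n → ℕ) : BetweennessStructure where
  X := Fin n
  btw x y z := d x y + d y z = d x z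

theorem ofDist_almostMetrizable {n : ℕ} [NeZero n] {d : Fin n → Fin n → ℕ}
    (h0 : ∀ x y, d x y = 0 ↔ x = y) (hs : ∀ x y, d x y = d y x)
    (ht : ∀ x y z, d x z ≤ d x y + d y z) : (ofDist n d).AlmostMetrizable where
  refl_left x z := by simp [(h0 x x).2 rfl]
  symm x y z (hb : d x y + d y z = d x z) := by
    change d z y + d y x = d z x
    rw [hs z y, hs y x, hs z x]
    omega
  antisymm x y z (hb : d x y + d y z = d x z) (hb' : d y x + d x z = d y z) := by
    rw [hs y x] at hb'
    exact (h0 x y).1 (by omega)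
  four_relations x y z w (hb : d x y + d y z = d x z) (hb' : d x w + d w y = d x y) := by
    change d x w + d w z = d x z ∧ d w y + d y z = d w z
    have := ht x w z
    have := ht w y z
    omega

/-- The distance on a line on which several points may share a position; such points are at
distance `t` from each other. -/
def twinDist {n : ℕ} (t : ℕ) (pos : Fin n → ℕ) (x y : Fin n) : ℕ :=
  if x = y then 0 else if pos x = pos y then t else (pos x - pos y) + (pos y - pos x)

section Twin

variable {n : ℕ} [NeZero n] {t : ℕ} {pos : Fin n → ℕ}

theorem twinDist_almostMetrizable (ht : t = 1 ∨ t = 2) :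
    (ofDist n (twinDist t pos)).AlmostMetrizable := by
  apply ofDist_almostMetrizable
  · intro x y
    unfold twinDist
    grind
  · intro x y
    unfold twinDist
    grind
  · intro x y z
    unfold twinDist
    grind

theorem col_twinDist_of_ne {x y z : Fin n} (hxy : pos x ≠ pos y) (hxz : pos x ≠ pos z)
    (hyz : pos y ≠ pos z) : (ofDist n (twinDist t pos)).Col x y z := by
  simp only [Col, twinDist]
  grind

/-- Twins are equally far, say r ≥ 1, from any point in another position, so collinearity means t =
2r. -/
theorem col_twinDist_iff (ht : t = 1 ∨ t = 2) {x y z : Fin n} (hne : x ≠ y)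
    (hxy : pos x = pos y) (hxz : pos x ≠ pos z) :
    (ofDist n (twinDist t pos)).Col x y z ↔
      t = 2 ∧ (pos z = pos x + 1 ∨ pos x = pos z + 1) := by
  simp only [Col, twinDist]
  grind

/-- The triangles consist of a pair of twins and a third point that is not a common neighbour. -/
theorem mem_triangles_twinDist (ht : t = 1 ∨ t = 2)
    (hpos : ∀ x y z, x ≠ y → x ≠ z → y ≠ z → pos x = pos y → pos x ≠ pos z)
    (T : Finset (Fin n)) :
    T ∈ (ofDist n (twinDist t pos)).triangles ↔ ∃ u v w, u < v ∧ pos u = pos v ∧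
      pos w ≠ pos u ∧ ¬ (t = 2 ∧ (pos w = pos u + 1 ∨ pos u = pos w + 1)) ∧
      T = {u, v, w} := by
  have h := twinDist_almostMetrizable (n := n) (pos := pos) ht
  constructor
  · rintro ⟨hT, hcol⟩
    obtain ⟨x, y, z, hxy, hxz, hyz, rfl⟩ := Finset.card_eq_three.1 hT
    have hc : ¬ (ofDist n (twinDist t pos)).Col x y z := fun hc =>
      hcol ((@AlmostMetrizable.collinear_triple _ h (instDecidableEqFin n) x y z hxy hxz hyz).2 hc)
    have key : ∀ x y z : Fin n, x ≠ y → x ≠ z → y ≠ z → pos x = pos y →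
        ¬ (ofDist n (twinDist t pos)).Col x y z →
        ∃ u v w, u < v ∧ pos u = pos v ∧ pos w ≠ pos u ∧
          ¬ (t = 2 ∧ (pos w = pos u + 1 ∨ pos u = pos w + 1)) ∧
          ({x, y, z} : Finset (Fin n)) = {u, v, w} := by
      intro x y z hxy hxz hyz hp hc
      have hp' := hpos x y z hxy hxz hyz hp
      rw [col_twinDist_iff ht hxy hp hp'] at hc
      rcases lt_or_gt_of_ne hxy with hlt | hlt
      · exact ⟨x, y, z, hlt, hp, hp'.symm, hc, rfl⟩
      · exact ⟨y, x, z, hlt, hp.symm, hp ▸ hp'.symm, hp ▸ hc, Finset.insert_comm _ _ _⟩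
    by_cases h1 : pos x = pos y
    · exact key x y z hxy hxz hyz h1 hc
    by_cases h2 : pos y = pos z
    · have := key y z x hyz hxy.symm hxz.symm h2 fun hc' => hc (col_rotate.2 hc')
      rwa [show ({y, z, x} : Finset (Fin n)) = {x, y, z} by ext; simp; tauto] at this
    by_cases h3 : pos x = pos z
    · have := key x z y hxz hxy hyz.symm h3 fun hc' => hc (h.col_comm.1 hc')
      rwa [show ({x, z, y} : Finset (Fin n)) = {x, y, z} by ext; simp; tauto] at this
    · exact absurd (col_twinDist_of_ne h1 h3 h2) hc
  · rintro ⟨u, v, w, huv, hp, hw, hn, rfl⟩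
    have huw : u ≠ w := fun e => hw (e ▸ rfl)
    have hvw : v ≠ w := fun e => hw (e ▸ hp.symm)
    refine ⟨Finset.card_eq_three.2 ⟨u, v, w, huv.ne, huw, hvw, rfl⟩, ?_⟩
    intro hcol
    exact hn ((col_twinDist_iff ht huv.ne hp hw.symm).1
      ((@AlmostMetrizable.collinear_triple _ h (instDecidableEqFin n) u v w huv.ne huw hvw).1 hcol))

end Twin

theorem card_image_insert_pair {α : Type*} [DecidableEq α] {N : Finset α} {u v : α}
    (hu : u ∉ N) (hv : v ∉ N) : (N.image fun k => ({u, v, k} : Finset α)).card = N.card := by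
  apply Finset.card_image_of_injOn
  intro k hk l hl hkl
  have : k ∈ ({u, v, l} : Finset α) := by
    rw [← show {u, v, k} = ({u, v, l} : Finset α) from hkl]
    simp
  simp only [Finset.mem_insert, Finset.mem_singleton] at this
  rcases this with rfl | rfl | e
  · exact absurd hk hu
  · exact absurd hk hv
  · exact e

theorem order_ofDist (n : ℕ) [NeZero n] (d : Fin n → Fin n → ℕ) : (ofDist n d).order = n :=
  Nat.card_fin n

theorem mem_B_ofDist {n : ℕ} [NeZero n] {d : Fin n → Fin n → ℕ}
    (h : (ofDist n d).AlmostMetrizable) {F : Finset (Finset (Fin n))}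
    (hF : ∀ T : Finset (Fin n), T ∈ (ofDist n d).triangles ↔ T ∈ F) : ofDist n d ∈ B n F.card := by
  refine ⟨h, by rw [order_ofDist], ?_⟩
  have h1 : (ofDist n d).triangles = (F : Set (Finset (Fin n))) := Set.ext hF
  exact congrArg Nat.cast ((congrArg Set.ncard h1).trans (Set.ncard_coe_finset F))

theorem B_five_zero_nonempty : (B 5 0).Nonempty := by
  have h := mem_B_ofDist (twinDist_almostMetrizable (n := 5) (t := 1) (pos := Fin.val) (.inl rfl))
    (F := ∅) fun T => by
      rw [mem_triangles_twinDist (.inl rfl) fun x y z hxy _ _ e => absurd (Fin.ext e) hxy]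
      simp only [Finset.notMem_empty, iff_false]
      rintro ⟨u, v, w, huv, e, -⟩
      exact huv.ne (Fin.ext e)
  exact ⟨_, h⟩

/-- A path whose first vertex is doubled by an adjacent twin. -/
theorem B_sub_two_nonempty {n : ℕ} (hn : 2 ≤ n) : (B n (n - 2)).Nonempty := by
  have : NeZero n := ⟨by omega⟩
  let u : Fin n := ⟨0, by omega⟩
  let v : Fin n := ⟨1, by omega⟩
  let F : Finset (Finset (Fin n)) := ({u, v}ᶜ : Finset (Fin n)).image fun k => {u, v, k}
  have hF : F.card = n - 2 := by
    rw [card_image_insert_pair (by simp) (by simp), Finset.card_compl, Fintype.card_fin,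
      Finset.card_pair (by simp [u, v])]
  -- Points 0 and 1 share position 1. Twins at distance 1 are collinear with no third point, so all
  -- n - 2 other points give triangles.
  have h := mem_B_ofDist (twinDist_almostMetrizable (n := n) (t := 1)
    (pos := fun k => max k.val 1) (.inl rfl)) (F := F) fun T => by
      rw [mem_triangles_twinDist (.inl rfl) (by intro x y z; grind)]
      simp only [F, Finset.mem_image, Finset.mem_compl, Finset.mem_insert, Finset.mem_singleton]
      constructor
      · rintro ⟨x, y, w, hxy, e, hw, -, rfl⟩
        obtain rfl : x = u := by grind
        obtain rfl : y = v := by grind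
        exact ⟨w, by grind, rfl⟩
      · rintro ⟨k, hk, rfl⟩
        exact ⟨u, v, k, Nat.zero_lt_one, by simp [u, v], by grind, by simp, rfl⟩
  rw [hF, Nat.cast_sub hn] at h
  exact ⟨_, h⟩

/-- A path in which two adjacent inner vertices are doubled by non-adjacent twins. -/
theorem B_two_mul_sub_ten_nonempty {n : ℕ} (hn : 6 ≤ n) : (B n (2 * n - 10)).Nonempty := by
  have : NeZero n := ⟨by omega⟩
  let e0 : Fin n := ⟨0, by omega⟩
  let e1 : Fin n := ⟨1, by omega⟩
  let e2 : Fin n := ⟨2, by omega⟩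
  let e3 : Fin n := ⟨3, by omega⟩
  let e4 : Fin n := ⟨4, by omega⟩
  let e5 : Fin n := ⟨5, by omega⟩
  let pos : Fin n → ℕ := fun k =>
    if k.val ≤ 1 then k.val else if k.val ≤ 3 then k.val - 1 else k.val - 2
  -- The twins `e1`, `e2` at position 1 have the common neighbours `e0`, `e3`, `e4`; the twins `e3`,
  -- `e4` at position 2 have `e1`, `e2`, `e5`. Each pair therefore forms n - 2 - 3 triangles.
  let F₁ : Finset (Finset (Fin n)) :=
    ({e0, e1, e2, e3, e4}ᶜ : Finset (Fin n)).image fun k => {e1, e2, k}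
  let F₂ : Finset (Finset (Fin n)) :=
    ({e1, e2, e3, e4, e5}ᶜ : Finset (Fin n)).image fun k => {e3, e4, k}
  have h1 : F₁.card = n - 5 := by
    rw [card_image_insert_pair (by simp) (by simp), Finset.card_compl, Fintype.card_fin]
    congr 1
  have h2 : F₂.card = n - 5 := by
    rw [card_image_insert_pair (by simp) (by simp), Finset.card_compl, Fintype.card_fin]
    congr 1
  have hdisj : Disjoint F₁ F₂ := by
    rw [Finset.disjoint_left]
    intro T hT1 hT2
    obtain ⟨k, hk, rfl⟩ := Finset.mem_image.1 hT1
    obtain ⟨l, hl, he⟩ := Finset.mem_image.1 hT2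
    have h3 : e3 ∈ ({e1, e2, k} : Finset (Fin n)) := by rw [← he]; simp
    simp only [Finset.mem_insert, Finset.mem_singleton, Finset.mem_compl] at h3 hk
    grind
  have h := mem_B_ofDist (twinDist_almostMetrizable (n := n) (t := 2) (pos := pos) (.inr rfl))
    (F := F₁ ∪ F₂) fun T => by
      rw [mem_triangles_twinDist (.inr rfl) (by intro x y z; grind)]
      simp only [F₁, F₂, Finset.mem_union, Finset.mem_image, Finset.mem_compl,
        Finset.mem_insert, Finset.mem_singleton]
      constructor
      · rintro ⟨x, y, w, hxy, e, hw, hn, rfl⟩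
        have hcase : x = e1 ∧ y = e2 ∨ x = e3 ∧ y = e4 := by grind
        rcases hcase with ⟨rfl, rfl⟩ | ⟨rfl, rfl⟩
        · exact .inl ⟨w, by grind, rfl⟩
        · exact .inr ⟨w, by grind, rfl⟩
      · rintro (⟨k, hk, rfl⟩ | ⟨k, hk, rfl⟩)
        · exact ⟨e1, e2, k, by simp [e1, e2], by simp [pos, e1, e2], by grind, by grind, rfl⟩
        · exact ⟨e3, e4, k, by simp [e3, e4], by simp [pos, e3, e4], by grind, by grind, rfl⟩
  rw [Finset.card_union_of_disjoint hdisj, h1, h2,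
    show ((n - 5 + (n - 5) : ℕ) : ℤ) = 2 * n - 10 by omega] at h
  exact ⟨_, h⟩

/-! ### The values of γ, σ and ϑ_max -/

/-- The doubled path needs six points; for order 5 the required co-size is 0, which a plain path
has. -/
theorem B_nonempty_of_five_le {n : ℤ} (hn : 5 ≤ n) : (B n (2 * n - 10)).Nonempty := by
  lift n to ℕ using by omega
  rcases hn.eq_or_lt with h | h
  · rw [← h]
    exact B_five_zero_nonempty
  · exact B_two_mul_sub_ten_nonempty (by omega)

theorem B_eq_empty_of_gap {n m : ℤ} (h1 : n - 2 < m) (h2 : m < 2 * n - 10) : B n m = ∅ := by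
  rw [Set.eq_empty_iff_forall_notMem]
  rintro 𝓑 ⟨h, ho, hc⟩
  -- An integer m strictly inside the gap forces n ≥ 10, so the order is large enough.
  have := h.coSize_gap (by omega)
  omega

theorem gamma_two_of_lt {c : ℤ} (hc : 10 < c) :
    gamma 2 c = (((c - 2 : ℤ) : WithTop ℤ) : WithBot (WithTop ℤ)) := by
  rw [gamma, extMax_eq_coe_iff]
  constructor
  · have := B_sub_two_nonempty (n := (c - 2).toNat) (by omega)
    rw [Int.toNat_of_nonneg (by omega)] at this
    rw [Set.mem_ofPred, ← Set.nonempty_iff_ne_empty]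
    convert this using 2
    ring
  · intro n hn
    by_contra! hlt
    exact hn (B_eq_empty_of_gap (by omega) (by omega))

theorem gamma_two_ten : gamma 2 10 = ⊤ := by
  rw [gamma, extMax_eq_top_iff]
  rintro ⟨b, hb⟩
  have := hb (a := max 5 (b + 1)) (B_nonempty_of_five_le (by simp)).ne_empty
  simp at this

theorem sigma_two_ten : sigma 2 10 = (((4 : ℤ) : WithTop ℤ) : WithBot (WithTop ℤ)) := by
  rw [sigma, extMax_eq_coe_iff]
  constructor
  · rw [Set.mem_ofPred, Set.eq_empty_iff_forall_notMem]
    rintro 𝓑 ⟨-, -, hc⟩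
    omega
  · intro n hn
    by_contra! hlt
    exact (B_nonempty_of_five_le (by omega)).ne_empty hn

theorem thetaMax_two : thetaMax 2 = (((10 : ℤ) : WithTop ℤ) : WithBot (WithTop ℤ)) := by
  rw [thetaMax, extMax_eq_coe_iff]
  refine ⟨gamma_two_ten, fun c (hc : gamma 2 c = ⊤) => ?_⟩
  by_contra! hlt
  rw [gamma_two_of_lt hlt] at hc
  exact WithTop.coe_ne_top (WithBot.coe_inj.1 hc)

end BetweennessStructure

theorem corollary2 :
    BetweennessStructure.thetaMax 2 = (((10 : ℤ) : WithTop ℤ) : WithBot (WithTop ℤ)) ∧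
    BetweennessStructure.sigma 2 10 = (((4 : ℤ) : WithTop ℤ) : WithBot (WithTop ℤ)) ∧
    (∀ c : ℤ, 10 < c →
      BetweennessStructure.gamma 2 c = (((c - 2 : ℤ) : WithTop ℤ) : WithBot (WithTop ℤ))) ∧
    BetweennessStructure.gamma 2 10 = ⊤ :=
  ⟨BetweennessStructure.thetaMax_two, BetweennessStructure.sigma_two_ten,
    fun _ => BetweennessStructure.gamma_two_of_lt, BetweennessStructure.gamma_two_ten⟩
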